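/- Let $(R,\mathfrak m)$ be a finite commutative local ring with identity, let $q$ be the cardinality of its residue field $R/\mathfrak m$, and let $|\mathfrak m|=q^{\beta}$. For $k\in\mathbb N$ put $U_R(k)=\{x^k : x\in R^*\}$ and let $G_R(k)=\mathrm{Cay}(R,U_R(k))$ be the Cayley graph with vertex set $R$ in which $v,w$ are adjacent if and only if $w-v\in U_R(k)$ (in every case below $U_R(k)=-U_R(k)$, so the graph is undirected). Let $\mathcal K_3(G)$ denote the number of cliques with $3$ vertices (triangles) in $G$. Then: (a) If $q\equiv 1\pmod 4$, then $$\mathcal K_3(G_R(2))=\frac{q^{3\beta+1}(q-1)(q-5)}{48}.$$ (b) Let $q=p^r$ with $p$ prime, and assume $3\mid q-1$ if $q$ is even and $6\mid q-1$ if $q$ is odd. If $p\equiv 1\pmod 3$, then there are $c,d\in\mathbb Z$ with $4q=c^2+27d^2$, $c\equiv 1\pmod 3$ and $p\nmid c$; take any such $c,d$. If $p\equiv 2\pmod 3$ (in which case $r$ is even), let $c=-2(-p)^{r/2}$. Then $$\mathcal K_3(G_R(3))=\frac{q^{3\beta+1}(q-1)(q+c-8)}{162}.$$ (c) Let $q=p^r\equiv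 1\pmod 8$ with $p$ prime. Then there are $e,f\in\mathbb Z$ with $q=e^2+4f^2$, $e\equiv 1\pmod 4$, and $p\nmid e$ in case $p\equiv 1\pmod 4$; for any such $e,f$, $$\mathcal K_3(G_R(4))=\frac{q^{3\beta+1}(q-1)(q-6e-11)}{2^7\cdot 3}.$$ -/

import Mathlib

/-- The set `U_R(k) = {x ^ k : x ∈ Rˣ}` of `k`-th powers of units of `R`. -/
def unitPowers (R : Type*) [CommRing R] (k : ℕ) : Set R :=
  {y | ∃ x : Rˣ, y = (x : R) ^ k}

/-- The graph `G_R(k) = Cay(R, U_R(k))`. When `-1 ∈ U_R(k)`, distinct `v`, `w` are adjacent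
if and only if `w - v ∈ U_R(k)`. -/
def unitaryCayley (R : Type*) [CommRing R] (k : ℕ) : SimpleGraph R :=
  SimpleGraph.addCayley (unitPowers R k)

/-- The number `K_ℓ(G)` of cliques with `ℓ` vertices in `G`. -/
noncomputable def numCliques {V : Type*} (ℓ : ℕ) (G : SimpleGraph V) : ℕ :=
  Nat.card {s : Finset V // G.IsNClique ℓ s}

/-! ### Characters, Jacobi sums and power sums over a finite field. -/

section FiniteField

open Finset

variable {F : Type*} [Field F] [Fintype F]

/-! Translating one vertex to `0` and scaling by a `k`-th power, an ordered triangle becomes `(0, 1,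
w)` with `w` and `1 - w` both `k`-th powers of units; so six times the number of triangles is `|R| *
|U_R(k)| * N`, where `N` counts such `w` (`six_mul_numCliques_three_unitaryCayley`). As `q ≡ 1 (mod
k)`, `k` is prime to `|𝔪|` and `k`-th powers are detected in the residue field `F`
(`mem_unitPowers_iff_residue_mem`). Each of the three factors is thus `q ^ β` times its value over
`F`.

Over `F`, orthogonality of characters turns `k ^ 2 * N` into a sum of Jacobi sums
(`sum_jacobiSum_pow_pow`). The only nontrivial values are, up to conjugation, one element of norm
`q` in `ℤ[ω]` (`k = 3`) or `ℤ[i]` (`k = 4`), whose trace is `c` or `-2e`.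

The trace must then be identified. Integrality of the counts gives its residue mod `3` or `4`. If `p
≡ 1 (mod k)`, counting again inside `F` shows that it is, up to sign, the binomial coefficient
`(2m).choose m` mod `p`, with `m = (q - 1) / k`; this is prime to `p` by Lucas, and a representation
prime to `p` is unique up to signs (`sq_eq_sq_of_add_mul_sq_eq`). Otherwise `p` is inert, so the
element is a unit times a power of `p`, and the congruence fixes what is needed of the unit. -/

theorem ne_zero_of_mem_unitPowers {F : Type*} [Field F] {k : ℕ} {y : F}
    (h : y ∈ unitPowers F k) : y ≠ 0 := by
  obtain ⟨x, rfl⟩ := h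
  exact pow_ne_zero _ x.ne_zero

/-- Euler's criterion for `k`-th powers in a finite field. -/
theorem mem_unitPowers_iff_pow_eq_one {k m : ℕ} (h : Fintype.card F - 1 = k * m)
    (y : F) : y ∈ unitPowers F k ↔ y ^ m = 1 := by
  classical
  have hpos : 0 < k * m := by
    have := Fintype.one_lt_card (α := F)
    lia
  have hm : 0 < m := Nat.pos_of_mul_pos_left hpos
  constructor
  · rintro ⟨x, rfl⟩
    rw [← pow_mul, ← h]
    exact FiniteField.pow_card_sub_one_eq_one _ x.ne_zero
  · intro hy
    have hy0 : y ≠ 0 := by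
      rintro rfl
      rw [zero_pow hm.ne'] at hy
      exact zero_ne_one hy
    obtain ⟨g, hg⟩ := IsCyclic.exists_generator (α := Fˣ)
    obtain ⟨i, hi⟩ := (mem_powers_iff_mem_zpowers.mpr (hg (Units.mk0 y hy0)))
    have hi : g ^ i = Units.mk0 y hy0 := hi
    have ho : orderOf g = k * m := by
      rw [orderOf_eq_card_of_forall_mem_zpowers hg, Nat.card_eq_fintype_card, Fintype.card_units, h]
    have hd : k * m ∣ i * m := by
      rw [← ho]
      apply orderOf_dvd_of_pow_eq_one
      rw [pow_mul, hi]
      ext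
      simpa using hy
    obtain ⟨j, rfl⟩ := Nat.dvd_of_mul_dvd_mul_right hm hd
    refine ⟨g ^ j, ?_⟩
    have := congrArg Units.val hi
    simp only [Units.val_pow_eq_pow_val, Units.val_mk0] at this ⊢
    rw [← this, ← pow_mul, mul_comm]

/-- A character of order `k` takes the value `1` exactly at the nonzero `k`-th powers. -/
theorem MulChar.apply_eq_one_iff_mem_unitPowers {χ : MulChar F ℂ} (y : F) :
    χ y = 1 ↔ y ∈ unitPowers F (orderOf χ) := by
  classical
  constructor
  · intro hy
    have hy0 : y ≠ 0 := by
      rintro rfl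
      rw [MulChar.map_zero] at hy
      exact zero_ne_one hy
    obtain ⟨g, hg⟩ := IsCyclic.exists_generator (α := Fˣ)
    obtain ⟨i, hi⟩ := (mem_powers_iff_mem_zpowers.mpr (hg (Units.mk0 y hy0)))
    have hi : g ^ i = Units.mk0 y hy0 := hi
    have hi' := congrArg Units.val hi
    simp only [Units.val_pow_eq_pow_val, Units.val_mk0] at hi'
    have hd : orderOf χ ∣ i := by
      apply orderOf_dvd_of_pow_eq_one
      rw [MulChar.eq_iff hg]
      rw [MulChar.pow_apply_coe, ← map_pow, hi', hy, MulChar.one_apply_coe]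
    obtain ⟨j, rfl⟩ := hd
    refine ⟨g ^ j, ?_⟩
    rw [← hi', Units.val_pow_eq_pow_val, ← pow_mul, mul_comm]
  · rintro ⟨x, rfl⟩
    rw [map_pow, ← MulChar.pow_apply_coe, pow_orderOf_eq_one, MulChar.one_apply_coe]

theorem MulChar.exists_orderOf_eq (F : Type*) [Field F] [Fintype F] {k : ℕ} (hk : k ≠ 0)
    (h : k ∣ Fintype.card F - 1) : ∃ χ : MulChar F ℂ, orderOf χ = k :=
  MulChar.exists_mulChar_orderOf F h (Complex.isPrimitiveRoot_exp k hk)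

open Classical in
/-- The sum of the powers of a character of order `k` is `k` times the indicator function of the
nonzero `k`-th powers. -/
theorem MulChar.sum_pow_apply (χ : MulChar F ℂ) (y : F) :
    ∑ i ∈ range (orderOf χ), (χ ^ i) y =
      if y ∈ unitPowers F (orderOf χ) then (orderOf χ : ℂ) else 0 := by
  by_cases hy0 : y = 0
  · subst hy0
    rw [if_neg fun h ↦ ne_zero_of_mem_unitPowers h rfl]
    exact sum_eq_zero fun i _ ↦ MulChar.map_zero _
  · have hu : ∀ i, (χ ^ i) y = χ y ^ i := fun i ↦ MulChar.pow_apply_coe χ i (Units.mk0 y hy0)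
    simp only [hu]
    split_ifs with hy
    · rw [← MulChar.apply_eq_one_iff_mem_unitPowers] at hy
      simp [hy]
    · rw [← MulChar.apply_eq_one_iff_mem_unitPowers] at hy
      rw [geom_sum_eq hy, ← hu, pow_orderOf_eq_one,
        MulChar.one_apply (isUnit_iff_ne_zero.mpr hy0), sub_self, zero_div]

/-- The number of ways of writing `1` as the sum of a `k`-th power of a unit and
an `l`-th power of a unit. -/
noncomputable def cyclotomicCount (R : Type*) [CommRing R] (k l : ℕ) : ℕ :=
  Nat.card {u : R | u ∈ unitPowers R k ∧ 1 - u ∈ unitPowers R l}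

open Classical in
theorem cyclotomicCount_eq_card_filter (R : Type*) [CommRing R] [Fintype R] (k l : ℕ) :
    cyclotomicCount R k l = #{u : R | u ∈ unitPowers R k ∧ 1 - u ∈ unitPowers R l} := by
  rw [cyclotomicCount, Nat.card_eq_fintype_card]
  exact Fintype.card_subtype _

/-- Exchanging the sums leaves, for each `x`, a product of two indicator functions, one at `x` and
one at `1 - x`. -/
theorem sum_jacobiSum_pow_pow (χ ψ : MulChar F ℂ) :
    ∑ i ∈ range (orderOf χ), ∑ j ∈ range (orderOf ψ), jacobiSum (χ ^ i) (ψ ^ j) =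
      orderOf χ * orderOf ψ * cyclotomicCount F (orderOf χ) (orderOf ψ) := by
  classical
  simp only [jacobiSum]
  have : ∀ i ∈ range (orderOf χ), ∑ j ∈ range (orderOf ψ), ∑ x : F, (χ ^ i) x * (ψ ^ j) (1 - x) =
      ∑ x : F, (χ ^ i) x * ∑ j ∈ range (orderOf ψ), (ψ ^ j) (1 - x) := by
    intro i _
    rw [sum_comm]
    simp only [mul_sum]
  rw [sum_congr rfl this, sum_comm]
  simp only [← sum_mul, MulChar.sum_pow_apply, cyclotomicCount_eq_card_filter]
  rw [card_filter, Nat.cast_sum, mul_sum]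
  refine sum_congr rfl fun x _ ↦ ?_
  split_ifs <;> simp_all

theorem card_unitPowers {k m : ℕ} (h : Fintype.card F - 1 = k * m) (hk : k ≠ 0) :
    Nat.card (unitPowers F k) = m := by
  classical
  obtain ⟨χ, rfl⟩ := MulChar.exists_orderOf_eq F hk ⟨m, h⟩
  have hsum : ∑ i ∈ range (orderOf χ), ∑ x : F, (χ ^ i) x = (orderOf χ * m : ℕ) := by
    rw [sum_eq_single 0]
    · rw [pow_zero, MulChar.sum_one_eq_card_units, Fintype.card_units, h]
    · intro i hi hi0
      apply MulChar.sum_eq_zero_of_ne_one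
      exact pow_ne_one_of_lt_orderOf hi0 (mem_range.mp hi)
    · intro h0
      exact absurd (mem_range.mpr (Nat.pos_of_ne_zero hk)) h0
  rw [sum_comm] at hsum
  simp only [MulChar.sum_pow_apply] at hsum
  rw [← sum_filter, sum_const, nsmul_eq_mul, mul_comm, Nat.cast_mul] at hsum
  have := mul_left_cancel₀ (Nat.cast_ne_zero.mpr hk) hsum
  rw [Nat.card_eq_fintype_card, Fintype.card_subtype]
  exact_mod_cast this

/-- The sum `∑ u, u ^ a * (1 - u) ^ b` over a finite field of cardinality `q` vanishes when
`a + b < q - 1`. -/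
theorem sum_pow_mul_one_sub_pow_of_lt {a b : ℕ} (h : a + b < Fintype.card F - 1) :
    ∑ u : F, u ^ a * (1 - u) ^ b = 0 := by
  have : ∀ u : F, u ^ a * (1 - u) ^ b =
      ∑ i ∈ range (b + 1), (-1) ^ i * (b.choose i : F) * u ^ (a + i) := by
    intro u
    rw [sub_eq_neg_add, add_pow, mul_sum]
    refine sum_congr rfl fun i _ ↦ ?_
    rw [neg_pow, one_pow]
    ring
  simp only [this]
  rw [sum_comm]
  refine sum_eq_zero fun i hi ↦ ?_
  rw [← mul_sum, FiniteField.sum_pow_lt_card_sub_one, mul_zero]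
  rw [mem_range] at hi
  lia

theorem sum_pow_card_sub_one : ∑ u : F, u ^ (Fintype.card F - 1) = -1 := by
  classical
  have h1 := Fintype.one_lt_card (α := F)
  rw [← sum_sdiff (subset_univ {(0 : F)}), sum_singleton, zero_pow (by lia), add_zero]
  rw [sum_congr rfl (g := fun _ ↦ 1)]
  · rw [sum_const, card_sdiff_of_subset (subset_univ _), card_univ, card_singleton, nsmul_eq_mul,
      Nat.cast_sub h1.le, FiniteField.cast_card_eq_zero]
    simp
  · intro u hu
    exact FiniteField.pow_card_sub_one_eq_one u (by simpa using hu)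

/-- The sum `∑ u, u ^ a * (1 - u) ^ b` over a finite field of cardinality `q`, with
`q - 1 ≤ a + b < 2 (q - 1)`, has only one monomial contributing to it. -/
theorem sum_pow_mul_one_sub_pow {a b j : ℕ} (hj : a + j = Fintype.card F - 1)
    (hjb : j ≤ b) (hb : a + b < 2 * (Fintype.card F - 1)) :
    ∑ u : F, u ^ a * (1 - u) ^ b = - ((-1) ^ j * (b.choose j : F)) := by
  classical
  have : ∀ u : F, u ^ a * (1 - u) ^ b =
      ∑ i ∈ range (b + 1), (-1) ^ i * (b.choose i : F) * u ^ (a + i) := by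
    intro u
    rw [sub_eq_neg_add, add_pow, mul_sum]
    refine sum_congr rfl fun i _ ↦ ?_
    rw [neg_pow, one_pow]
    ring
  simp only [this]
  rw [sum_comm, sum_eq_single j]
  · rw [← mul_sum, hj, sum_pow_card_sub_one, mul_neg, mul_one]
  · intro i hi hij
    rw [mem_range] at hi
    rw [← mul_sum]
    rcases lt_or_gt_of_ne hij with hlt | hgt
    · rw [FiniteField.sum_pow_lt_card_sub_one, mul_zero]
      lia
    -- Exponents above `q - 1` drop by `q - 1` and stay positive and below `q - 1`, where power sums
    -- vanish.
    · have h1 : ∀ u : F, u ^ (a + i) = u ^ (a + i - (Fintype.card F - 1)) := by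
        intro u
        by_cases hu : u = 0
        · rw [hu, zero_pow (by lia), zero_pow (by lia)]
        · conv_lhs => rw [show a + i = a + i - (Fintype.card F - 1) + (Fintype.card F - 1) by lia,
            pow_add, FiniteField.pow_card_sub_one_eq_one u hu, mul_one]
      simp only [h1]
      rw [FiniteField.sum_pow_lt_card_sub_one, mul_zero]
      lia
  · intro h
    simp only [mem_range] at h
    lia

open Classical in
/-- In a finite field, `∑ y ^ (m * i)` is `k` times the indicator function of the
nonzero `k`-th powers, apart from the value `1` at `0`. -/
theorem sum_pow_eq_ite {k m : ℕ} (h : Fintype.card F - 1 = k * m) (hk : k ≠ 0) (y : F) :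
    ∑ i ∈ range k, y ^ (m * i) =
      (if y ∈ unitPowers F k then (k : F) else 0) + if y = 0 then 1 else 0 := by
  have hm : m ≠ 0 := by
    rintro rfl
    have := Fintype.one_lt_card (α := F)
    lia
  by_cases hy0 : y = 0
  · subst hy0
    rw [if_neg fun h ↦ ne_zero_of_mem_unitPowers h rfl, if_pos rfl, sum_eq_single 0]
    · simp
    · intro i _ hi
      exact zero_pow (mul_ne_zero hm hi)
    · intro h0
      exact absurd (mem_range.mpr (Nat.pos_of_ne_zero hk)) h0
  · rw [if_neg hy0, add_zero]
    simp only [pow_mul]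
    split_ifs with hy
    · rw [mem_unitPowers_iff_pow_eq_one h] at hy
      simp [hy]
    · rw [mem_unitPowers_iff_pow_eq_one h] at hy
      rw [geom_sum_eq hy, ← pow_mul, mul_comm, ← h, FiniteField.pow_card_sub_one_eq_one y hy0,
        sub_self, zero_div]

/-- The analogue of `sum_jacobiSum_pow_pow` with values in `F`, giving the count modulo the
characteristic. The terms `k` and `l` come from `u = 1` and `u = 0`, because `0 ^ 0 = 1`. -/
theorem sum_sum_pow_mul_one_sub_pow {k l m n : ℕ} (h : Fintype.card F - 1 = k * m)
    (h' : Fintype.card F - 1 = l * n) (hk : k ≠ 0) (hl : l ≠ 0) :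
    ∑ i ∈ range k, ∑ j ∈ range l, ∑ u : F, u ^ (m * i) * (1 - u) ^ (n * j) =
      (k * l * cyclotomicCount F k l + k + l : F) := by
  classical
  have : ∀ i ∈ range k, ∑ j ∈ range l, ∑ x : F, x ^ (m * i) * (1 - x) ^ (n * j) =
      ∑ x : F, x ^ (m * i) * ∑ j ∈ range l, (1 - x) ^ (n * j) := by
    intro i _
    rw [sum_comm]
    simp only [mul_sum]
  rw [sum_congr rfl this, sum_comm]
  simp only [← sum_mul, sum_pow_eq_ite h hk, sum_pow_eq_ite h' hl]
  have h1k : (1 : F) ∈ unitPowers F k := ⟨1, by simp⟩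
  have h1l : (1 : F) ∈ unitPowers F l := ⟨1, by simp⟩
  have hterm : ∀ x : F, ((if x ∈ unitPowers F k then (k : F) else 0) + if x = 0 then 1 else 0) *
      ((if 1 - x ∈ unitPowers F l then (l : F) else 0) + if 1 - x = 0 then 1 else 0) =
      (k * l * if x ∈ unitPowers F k ∧ 1 - x ∈ unitPowers F l then 1 else 0) +
      (if x = 1 then (k : F) else 0) + (if x = 0 then (l : F) else 0) := by
    intro x
    by_cases hx0 : x = 0
    · subst hx0
      have : (0 : F) ∉ unitPowers F k := fun h ↦ ne_zero_of_mem_unitPowers h rfl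
      simp [this, h1l]
    by_cases hx1 : x = 1
    · subst hx1
      have : (0 : F) ∉ unitPowers F l := fun h ↦ ne_zero_of_mem_unitPowers h rfl
      simp [this, h1k]
    have hx1' : 1 - x ≠ 0 := sub_ne_zero.mpr (Ne.symm hx1)
    simp only [hx0, hx1, hx1', if_false, add_zero]
    split_ifs <;> simp_all
  simp only [hterm, sum_add_distrib, ← mul_sum]
  simp [cyclotomicCount_eq_card_filter]

/-- A symmetry of Jacobi sums coming from the involution `x ↦ x / (x - 1)`. -/
theorem jacobiSum_eq_apply_neg_one_mul {R : Type*} [CommRing R] (χ ψ : MulChar F R) :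
    jacobiSum χ ψ = χ (-1) * jacobiSum χ (χ * ψ)⁻¹ := by
  classical
  have hsplit : ∀ φ : MulChar F R, jacobiSum χ φ = ∑ x ∈ univ \ {1}, χ x * φ (1 - x) := by
    intro φ
    rw [jacobiSum, ← sum_sdiff (subset_univ {(1 : F)}), sum_singleton, sub_self, φ.map_zero,
      mul_zero, add_zero]
  rw [hsplit, hsplit, mul_sum]
  have hmem : ∀ x ∈ (univ : Finset F) \ {1}, x - 1 ≠ 0 := fun x hx ↦
    sub_ne_zero.mpr (by simpa using hx)
  have hmap : ∀ x ∈ (univ : Finset F) \ {1}, x / (x - 1) ∈ (univ : Finset F) \ {1} := by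
    intro x hx
    have := hmem x hx
    simp only [mem_sdiff, mem_univ, mem_singleton, true_and]
    rw [div_eq_one_iff_eq this]
    intro h
    have : (1 : F) = 0 := by linear_combination h
    exact one_ne_zero this
  have hinv : ∀ x ∈ (univ : Finset F) \ {1}, x / (x - 1) / (x / (x - 1) - 1) = x := by
    intro x hx
    have := hmem x hx
    rw [div_sub_one this, sub_sub_cancel]
    field_simp
  refine sum_bij' (fun x _ ↦ x / (x - 1)) (fun x _ ↦ x / (x - 1)) hmap hmap hinv hinv ?_
  intro x hx
  have h := hmem x hx
  have e1 : (1 : F) - x / (x - 1) = (1 - x)⁻¹ := by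
    have h' : 1 - x ≠ 0 := by rw [← neg_sub]; exact neg_ne_zero.mpr h
    field_simp
    ring
  rw [e1, ← MulChar.inv_apply' , inv_inv, MulChar.mul_apply, ← mul_assoc, ← mul_assoc, ← map_mul,
    ← map_mul]
  congr 2
  field_simp
  ring

end FiniteField

/-! ### Cyclotomic numbers of orders 2, 3 and 4, as integers and modulo `p`. -/

section Evaluation

open Finset

variable {F : Type*} [Field F] [Fintype F]

theorem jacobiSum_inv_inv_eq_conj (χ ψ : MulChar F ℂ) :
    jacobiSum χ⁻¹ ψ⁻¹ = starRingEnd ℂ (jacobiSum χ ψ) := by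
  simp only [jacobiSum, map_sum, map_mul, ← MulChar.star_apply']
  rfl

theorem exists_eq_add_mul_of_mem_adjoin {A : Type*} [CommRing A] {μ x : A} {s t : ℤ}
    (hμ : μ ^ 2 = s + t * μ) (hx : x ∈ Algebra.adjoin ℤ {μ}) :
    ∃ a b : ℤ, x = a + b * μ := by
  induction hx using Algebra.adjoin_induction with
  | mem x hx =>
    rw [Set.mem_singleton_iff] at hx
    exact ⟨0, 1, by simp [hx]⟩
  | algebraMap r => exact ⟨r, 0, by simp⟩
  | add x y _ _ hx hy =>
    obtain ⟨a, b, rfl⟩ := hx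
    obtain ⟨c, d, rfl⟩ := hy
    exact ⟨a + c, b + d, by push_cast; ring⟩
  | mul x y _ _ hx hy =>
    obtain ⟨a, b, rfl⟩ := hx
    obtain ⟨c, d, rfl⟩ := hy
    exact ⟨a * c + b * d * s, a * d + b * c + b * d * t, by
      push_cast; linear_combination (b * d : A) * hμ⟩

theorem jacobiSum_mul_conj {χ ψ : MulChar F ℂ} (hχ : χ ≠ 1) (hψ : ψ ≠ 1) (h : χ * ψ ≠ 1) :
    jacobiSum χ ψ * starRingEnd ℂ (jacobiSum χ ψ) = Fintype.card F := by
  rw [← jacobiSum_inv_inv_eq_conj]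
  refine jacobiSum_mul_jacobiSum_inv ?_ hχ hψ h
  simpa only [ringChar.eq_zero] using (CharP.ringChar_ne_zero_of_finite F).symm

theorem jacobiSum_inv_self {χ : MulChar F ℂ} (hχ : χ ≠ 1) (h : χ (-1) = 1) :
    jacobiSum χ χ⁻¹ = -1 := by
  rw [jacobiSum_nontrivial_inv hχ, h]

theorem jacobiSum_nontrivial_one {χ : MulChar F ℂ} (hχ : χ ≠ 1) : jacobiSum χ 1 = -1 := by
  rw [jacobiSum_comm, jacobiSum_one_nontrivial hχ]

/-- The four Jacobi sums are `q - 2` and three times `-1`. -/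
theorem four_mul_cyclotomicCount_two_two (h2 : 2 ∣ Fintype.card F - 1)
    (h : (-1 : F) ∈ unitPowers F 2) :
    4 * (cyclotomicCount F 2 2 : ℤ) = Fintype.card F - 5 := by
  obtain ⟨χ, hχ⟩ := MulChar.exists_orderOf_eq F two_ne_zero h2
  have hneg : χ (-1) = 1 := by rwa [MulChar.apply_eq_one_iff_mem_unitPowers, hχ]
  have h1 : χ ≠ 1 := by
    rintro rfl
    simp at hχ
  have hinv : χ⁻¹ = χ := by
    rw [inv_eq_iff_mul_eq_one, ← sq, ← hχ, pow_orderOf_eq_one]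
  have hs := sum_jacobiSum_pow_pow χ χ
  have hJ := jacobiSum_inv_self h1 hneg
  rw [hinv] at hJ
  simp only [hχ, sum_range_succ, range_zero, sum_empty, zero_add, pow_zero, pow_one,
    jacobiSum_one_one, jacobiSum_one_nontrivial h1, jacobiSum_nontrivial_one h1, hJ] at hs
  have : (4 * (cyclotomicCount F 2 2 : ℤ) : ℂ) = Fintype.card F - 5 := by
    push_cast
    linear_combination -hs
  exact_mod_cast this

/-- The trivial pair gives `q - 2`, six others give `-1`, and the last two are `J(χ, χ) = a + b * ω`
and its conjugate, of norm `q` and trace `2 * a - b`. -/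
theorem exists_nine_mul_cyclotomicCount_three_three (h3 : 3 ∣ Fintype.card F - 1) :
    ∃ a b : ℤ, (Fintype.card F : ℤ) = a ^ 2 - a * b + b ^ 2 ∧
      9 * (cyclotomicCount F 3 3 : ℤ) = Fintype.card F - 8 + (2 * a - b) := by
  obtain ⟨χ, hχ⟩ := MulChar.exists_orderOf_eq F three_ne_zero h3
  have hneg : χ (-1) = 1 := by
    rw [MulChar.apply_eq_one_iff_mem_unitPowers, hχ]
    exact ⟨-1, by norm_num⟩
  have h1 : χ ≠ 1 := by
    rintro rfl
    simp at hχ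
  have hcube : χ ^ 3 = 1 := by rw [← hχ, pow_orderOf_eq_one]
  have hinv : χ ^ 2 = χ⁻¹ := by
    rw [eq_inv_iff_mul_eq_one, ← pow_succ, hcube]
  have h1' : χ⁻¹ ≠ 1 := by rwa [Ne, inv_eq_one]
  have hneg' : χ⁻¹ (-1) = 1 := by rw [← hinv, MulChar.pow_apply' _ two_ne_zero, hneg, one_pow]
  have hs := sum_jacobiSum_pow_pow χ χ
  have hJ := jacobiSum_inv_self h1 hneg
  have hJ' := jacobiSum_inv_self h1' hneg'
  rw [inv_inv] at hJ'
  simp only [hχ, sum_range_succ, range_zero, sum_empty, zero_add, pow_zero, pow_one, hinv,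
    jacobiSum_one_one, jacobiSum_one_nontrivial h1, jacobiSum_nontrivial_one h1, hJ,
    jacobiSum_one_nontrivial h1', jacobiSum_nontrivial_one h1', hJ',
    jacobiSum_inv_inv_eq_conj] at hs
  have hn := jacobiSum_mul_conj h1 h1 (by rwa [← sq, hinv])
  have hμ := Complex.isPrimitiveRoot_exp 3 three_ne_zero
  have hmem := jacobiSum_mem_algebraAdjoin_of_pow_eq_one hcube hcube hμ
  set μ := Complex.exp (2 * Real.pi * Complex.I / (3 : ℕ)) with hμdef
  have hμ2 : μ ^ 2 = -1 - μ := by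
    have := hμ.geom_sum_eq_zero (by norm_num)
    simp only [sum_range_succ, range_zero, sum_empty, zero_add, pow_zero, pow_one] at this
    linear_combination this
  have hconj : starRingEnd ℂ μ = -1 - μ := by
    rw [← Complex.inv_eq_conj (hμ.norm'_eq_one (by norm_num)), ← hμ2]
    refine inv_eq_of_mul_eq_one_right ?_
    rw [← pow_succ']
    exact hμ.pow_eq_one
  obtain ⟨a, b, hab⟩ := exists_eq_add_mul_of_mem_adjoin (s := -1) (t := -1)
    (by push_cast; linear_combination hμ2) hmem
  rw [hab] at hs hn
  simp only [map_add, map_mul, map_intCast, hconj] at hs hn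
  refine ⟨a, b, ?_, ?_⟩
  · have : ((Fintype.card F : ℤ) : ℂ) = a ^ 2 - a * b + b ^ 2 := by
      push_cast
      linear_combination -hn - (b : ℂ) ^ 2 * hμ2
    exact_mod_cast this
  · have : (9 * (cyclotomicCount F 3 3 : ℤ) : ℂ) = Fintype.card F - 8 + (2 * a - b) := by
      push_cast
      linear_combination -hs
    exact_mod_cast this

/-- With `ρ = χ ^ 2` and `χ (-1) = 1`, the involution symmetry gives `J(χ, χ) = J(χ, ρ) = a + b *
i`, so the six nontrivial sums add up to `6 * a`. The mixed count of type `(4, 2)` involves the same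
`a`, with coefficient `2`; it yields the residue of `a` mod `4` and its reduction mod `p`. -/
theorem exists_sixteen_mul_cyclotomicCount_four_four (h4 : 4 ∣ Fintype.card F - 1)
    (h : (-1 : F) ∈ unitPowers F 4) :
    ∃ a b : ℤ, (Fintype.card F : ℤ) = a ^ 2 + b ^ 2 ∧
      16 * (cyclotomicCount F 4 4 : ℤ) = Fintype.card F - 11 + 6 * a ∧
      8 * (cyclotomicCount F 4 2 : ℤ) = Fintype.card F - 7 + 2 * a := by
  obtain ⟨χ, hχ⟩ := MulChar.exists_orderOf_eq F four_ne_zero h4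
  have hneg : χ (-1) = 1 := by rwa [MulChar.apply_eq_one_iff_mem_unitPowers, hχ]
  have h1 : χ ≠ 1 := by
    rintro rfl
    simp at hχ
  have hfour : χ ^ 4 = 1 := by rw [← hχ, pow_orderOf_eq_one]
  have hinv : χ ^ 3 = χ⁻¹ := by
    rw [eq_inv_iff_mul_eq_one, ← pow_succ, hfour]
  have h1' : χ⁻¹ ≠ 1 := by rwa [Ne, inv_eq_one]
  have hneg' : χ⁻¹ (-1) = 1 := by
    rw [← hinv, MulChar.pow_apply' _ three_ne_zero, hneg, one_pow]
  obtain ⟨ρ, hρ⟩ : ∃ ρ, ρ = χ ^ 2 := ⟨_, rfl⟩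
  have hρo : orderOf ρ = 2 := by
    rw [hρ, orderOf_pow' _ two_ne_zero, hχ]
    norm_num
  have hρ1 : ρ ≠ 1 := by
    rintro h
    simp [h] at hρo
  have hρneg : ρ (-1) = 1 := by rw [hρ, MulChar.pow_apply' _ two_ne_zero, hneg, one_pow]
  have hρinv : ρ⁻¹ = ρ := by
    rw [inv_eq_iff_mul_eq_one, ← sq, ← hρo, pow_orderOf_eq_one]
  have hJ := jacobiSum_inv_self h1 hneg
  have hJ' := jacobiSum_inv_self h1' hneg'
  rw [inv_inv] at hJ'
  have hJρ := jacobiSum_inv_self hρ1 hρneg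
  rw [hρinv] at hJρ
  have hJχρ : jacobiSum χ χ = jacobiSum χ ρ := by
    rw [jacobiSum_eq_apply_neg_one_mul, hneg, one_mul, ← sq, ← hρ, hρinv]
  have hconjρ : jacobiSum χ⁻¹ ρ = starRingEnd ℂ (jacobiSum χ ρ) := by
    rw [← jacobiSum_inv_inv_eq_conj, hρinv]
  have hs := sum_jacobiSum_pow_pow χ χ
  have hs' := sum_jacobiSum_pow_pow χ ρ
  simp only [hχ, hρo, sum_range_succ, range_zero, sum_empty, zero_add, pow_zero, pow_one, hinv,
    jacobiSum_one_one, jacobiSum_one_nontrivial h1, jacobiSum_nontrivial_one h1, hJ,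
    jacobiSum_one_nontrivial h1', jacobiSum_nontrivial_one h1', hJ', ← hρ, hJρ,
    jacobiSum_one_nontrivial hρ1, jacobiSum_nontrivial_one hρ1, jacobiSum_comm ρ χ,
    jacobiSum_comm ρ χ⁻¹,
    jacobiSum_inv_inv_eq_conj, hJχρ, hconjρ] at hs hs'
  have hn := jacobiSum_mul_conj h1 hρ1 (by rwa [hρ, ← pow_succ', hinv])
  have hμ := Complex.isPrimitiveRoot_I
  have hmem := jacobiSum_mem_algebraAdjoin_of_pow_eq_one hfour
    (show ρ ^ 4 = 1 by rw [hρ, ← pow_mul, mul_comm, pow_mul, hfour, one_pow]) hμ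
  obtain ⟨a, b, hab⟩ := exists_eq_add_mul_of_mem_adjoin (s := -1) (t := 0)
    (by simp) hmem
  rw [hab] at hs hn hs'
  simp only [map_add, map_mul, map_intCast, Complex.conj_I] at hs hn hs'
  refine ⟨a, b, ?_, ?_, ?_⟩
  · have : ((Fintype.card F : ℤ) : ℂ) = a ^ 2 + b ^ 2 := by
      push_cast
      linear_combination -hn - (b : ℂ) ^ 2 * Complex.I_sq
    exact_mod_cast this
  · have : (16 * (cyclotomicCount F 4 4 : ℤ) : ℂ) = Fintype.card F - 11 + 6 * a := by
      push_cast
      linear_combination -hs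
    exact_mod_cast this
  · have : (8 * (cyclotomicCount F 4 2 : ℤ) : ℂ) = Fintype.card F - 7 + 2 * a := by
      push_cast
      linear_combination -hs'
    exact_mod_cast this

/-- Only the exponents `(m, 2m)`, `(2m, m)` and `(2m, 2m)` have total degree at least `q - 1`; they
contribute `-1`, `-1` and minus the binomial coefficient. Evenness of `m` removes the signs. -/
theorem nine_mul_cyclotomicCount_three_three_cast {m : ℕ} (h : Fintype.card F - 1 = 3 * m)
    (hm : Even m) :
    (9 * cyclotomicCount F 3 3 : F) = - 8 - ((2 * m).choose m : F) := by
  have hs := sum_sum_pow_mul_one_sub_pow h h three_ne_zero three_ne_zero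
  have h0 := Fintype.one_lt_card (α := F)
  simp only [sum_range_succ, range_zero, sum_empty, zero_add] at hs
  rw [sum_pow_mul_one_sub_pow_of_lt (a := m * 0) (b := m * 0) (by lia),
    sum_pow_mul_one_sub_pow_of_lt (a := m * 0) (b := m * 1) (by lia),
    sum_pow_mul_one_sub_pow_of_lt (a := m * 0) (b := m * 2) (by lia),
    sum_pow_mul_one_sub_pow_of_lt (a := m * 1) (b := m * 0) (by lia),
    sum_pow_mul_one_sub_pow_of_lt (a := m * 1) (b := m * 1) (by lia),
    sum_pow_mul_one_sub_pow_of_lt (a := m * 2) (b := m * 0) (by lia),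
    sum_pow_mul_one_sub_pow (a := m * 1) (b := m * 2) (j := 2 * m) (by lia) (by lia) (by lia),
    sum_pow_mul_one_sub_pow (a := m * 2) (b := m * 1) (j := m) (by lia) (by lia) (by lia),
    sum_pow_mul_one_sub_pow (a := m * 2) (b := m * 2) (j := m) (by lia) (by lia) (by lia),
    hm.neg_one_pow, (even_two_mul m).neg_one_pow, mul_one, mul_comm m 2, Nat.choose_self,
    Nat.choose_self] at hs
  push_cast at hs
  linear_combination -hs

theorem eight_mul_cyclotomicCount_four_two_cast {m : ℕ} (h : Fintype.card F - 1 = 4 * m)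
    (hm : Even m) :
    (8 * cyclotomicCount F 4 2 : F) = - 7 - ((2 * m).choose m : F) := by
  have hs := sum_sum_pow_mul_one_sub_pow h (n := 2 * m) (l := 2) (by lia) four_ne_zero two_ne_zero
  have h0 := Fintype.one_lt_card (α := F)
  simp only [sum_range_succ, range_zero, sum_empty, zero_add] at hs
  rw [sum_pow_mul_one_sub_pow_of_lt (a := m * 0) (b := 2 * m * 0) (by lia),
    sum_pow_mul_one_sub_pow_of_lt (a := m * 0) (b := 2 * m * 1) (by lia),
    sum_pow_mul_one_sub_pow_of_lt (a := m * 1) (b := 2 * m * 0) (by lia),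
    sum_pow_mul_one_sub_pow_of_lt (a := m * 1) (b := 2 * m * 1) (by lia),
    sum_pow_mul_one_sub_pow_of_lt (a := m * 2) (b := 2 * m * 0) (by lia),
    sum_pow_mul_one_sub_pow_of_lt (a := m * 3) (b := 2 * m * 0) (by lia),
    sum_pow_mul_one_sub_pow (a := m * 2) (b := 2 * m * 1) (j := 2 * m) (by lia) (by lia) (by lia),
    sum_pow_mul_one_sub_pow (a := m * 3) (b := 2 * m * 1) (j := m) (by lia) (by lia) (by lia),
    hm.neg_one_pow, (even_two_mul m).neg_one_pow, mul_one,
    Nat.choose_self] at hs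
  push_cast at hs
  linear_combination -hs

end Evaluation

/-! ### Binary quadratic forms representing prime powers, and a binomial coefficient mod `p`. -/

section Arithmetic

/-- A primitive representation of `n * p ^ r` by `e ^ 2 + D * f ^ 2` is unique up to signs,
when `n ^ 2 < D`. -/
theorem sq_eq_sq_of_add_mul_sq_eq {p r : ℕ} (hp : p.Prime) (hp2 : p ≠ 2) (hr : r ≠ 0)
    {n D e f e' f' : ℤ} (hn : n ≠ 0) (hD : n ^ 2 < D) (h : n * (p : ℤ) ^ r = e ^ 2 + D * f ^ 2)
    (h' : n * (p : ℤ) ^ r = e' ^ 2 + D * f' ^ 2) (he : ¬ (p : ℤ) ∣ e) (he' : ¬ (p : ℤ) ∣ e') :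
    e ^ 2 = e' ^ 2 := by
  have hpz : Prime (p : ℤ) := Nat.prime_iff_prime_int.mp hp
  have hq : (0 : ℤ) < (p : ℤ) ^ r := pow_pos (by exact_mod_cast hp.pos) _
  have hpq : (p : ℤ) ∣ (p : ℤ) ^ r := dvd_pow_self _ hr
  have hprod : (e * f' - e' * f) * (e * f' + e' * f) = (p : ℤ) ^ r * (n * (f' ^ 2 - f ^ 2)) := by
    linear_combination -f' ^ 2 * h + f ^ 2 * h'
  -- By Brahmagupta's identity, `e * g - e' * f = p ^ r * t` gives `D * t ^ 2 ≤ n ^ 2 < D`, hence `t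
  -- = 0` and the two representations are proportional.
  have key : ∀ g : ℤ, g ^ 2 = f' ^ 2 → (p : ℤ) ^ r ∣ e * g - e' * f → e ^ 2 = e' ^ 2 := by
    intro g hg ⟨t, ht⟩
    have hid : ((p : ℤ) ^ r) ^ 2 * n ^ 2 = (e * e' + D * f * g) ^ 2 + D * ((p : ℤ) ^ r * t) ^ 2 := by
      rw [← ht]
      rw [← hg] at h'
      linear_combination (n * (p : ℤ) ^ r) * h + (e ^ 2 + D * f ^ 2) * h'
    have hle : ((p : ℤ) ^ r) ^ 2 * (D * t ^ 2) ≤ ((p : ℤ) ^ r) ^ 2 * n ^ 2 := by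
      nlinarith [sq_nonneg (e * e' + D * f * g)]
    have hle' : D * t ^ 2 ≤ n ^ 2 := le_of_mul_le_mul_left hle (by positivity)
    have ht0 : t = 0 := by
      by_contra h0
      have : 0 < t ^ 2 := by positivity
      nlinarith [sq_nonneg n]
    rw [ht0, mul_zero, sub_eq_zero] at ht
    have h1 : n * (p : ℤ) ^ r * (g ^ 2 - f ^ 2) = 0 := by
      rw [← hg] at h'
      linear_combination g ^ 2 * h - f ^ 2 * h' + (e * g + e' * f) * ht
    have h2 : g ^ 2 - f ^ 2 = 0 := (mul_eq_zero.mp h1).resolve_left (mul_ne_zero hn hq.ne')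
    linear_combination h' - h + D * h2 - D * hg
  -- Since `p` misses one factor of `hprod`, all of `p ^ r` divides the other.
  have hnot : ¬ ((p : ℤ) ∣ e * f' - e' * f ∧ (p : ℤ) ∣ e * f' + e' * f) := by
    rintro ⟨h1, h2⟩
    have h3 : (p : ℤ) ∣ 2 * (e * f') := by
      have := dvd_add h1 h2
      rwa [show e * f' - e' * f + (e * f' + e' * f) = 2 * (e * f') by ring] at this
    have h2' : ¬ (p : ℤ) ∣ 2 := by
      intro h
      have : p ∣ 2 := by exact_mod_cast h
      exact hp2 ((Nat.prime_dvd_prime_iff_eq hp Nat.prime_two).mp this)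
    have hf : (p : ℤ) ∣ f' := by
      rcases hpz.dvd_or_dvd h3 with h | h
      · exact absurd h h2'
      · exact (hpz.dvd_or_dvd h).resolve_left he
    apply he'
    apply hpz.dvd_of_dvd_pow (n := 2)
    rw [show e' ^ 2 = n * (p : ℤ) ^ r - D * f' ^ 2 by linear_combination -h']
    exact dvd_sub (hpq.mul_left _) ((dvd_pow hf two_ne_zero).mul_left _)
  by_cases h1 : (p : ℤ) ∣ e * f' - e' * f
  · have h2 : ¬ (p : ℤ) ∣ e * f' + e' * f := fun h2 ↦ hnot ⟨h1, h2⟩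
    refine key f' rfl ?_
    exact (((hpz.coprime_iff_not_dvd).mpr h2).pow_left).dvd_of_dvd_mul_right ⟨_, hprod⟩
  · refine key (-f') (by ring) ?_
    have := (((hpz.coprime_iff_not_dvd).mpr h1).pow_left (m := r)).dvd_of_dvd_mul_left ⟨_, hprod⟩
    rw [show e * -f' - e' * f = -(e * f' + e' * f) by ring]
    exact (dvd_neg).mpr this

/-- If `p ≡ 1 (mod k)` with `k ≥ 2` and `k * m = p ^ r - 1`, there are no carries in adding `m` to
itself in base `p`, so `p` does not divide the central binomial coefficient of `m`. -/
theorem Nat.Prime.not_dvd_choose_two_mul {p k t r m : ℕ} (hp : p.Prime) (hk : 2 ≤ k)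
    (hpk : p = k * t + 1) (hm : p ^ r = k * m + 1) : ¬ p ∣ (2 * m).choose m := by
  have : Fact p.Prime := ⟨hp⟩
  induction r generalizing m with
  | zero =>
    have : m = 0 := by
      rw [pow_zero] at hm
      have : k * m = 0 := by lia
      rcases Nat.mul_eq_zero.mp this with h | h <;> lia
    simp [this, hp.one_lt.ne']
  | succ r ih =>
    obtain ⟨n, hn⟩ : ∃ n, p ^ r = k * n + 1 := by
      have h1 : p ≡ 1 [MOD k] := by
        rw [hpk]
        simp [Nat.ModEq]
      have h2 : p ^ r ≡ 1 [MOD k] := by simpa using h1.pow r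
      have h3 := (Nat.modEq_iff_dvd' (Nat.one_le_pow _ _ hp.pos)).mp h2.symm
      obtain ⟨n, hn⟩ := h3
      have := Nat.one_le_pow r p hp.pos
      exact ⟨n, by lia⟩
    -- The lowest base-`p` digit of `m` is `t`, and `2 * t < p`: doubling produces no carry, and
    -- Lucas peels off one digit.
    have hmn : m = t + p * n := by
      have : k * m = k * (t + p * n) := by
        have : k * m + 1 = k * (t + p * n) + 1 := by
          rw [← hm, pow_succ, hn]
          linear_combination hpk
        lia
      exact Nat.eq_of_mul_eq_mul_left (by lia) this
    have h2t : 2 * t < p := by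
      have : 2 * t ≤ k * t := Nat.mul_le_mul_right _ hk
      lia
    have hlucas := Choose.choose_modEq_choose_mod_mul_choose_div_nat (n := 2 * m) (k := m) (p := p)
    have e1 : 2 * m = 2 * t + p * (2 * n) := by rw [hmn]; ring
    rw [e1, hmn, Nat.add_mul_mod_self_left, Nat.add_mul_mod_self_left,
      Nat.add_mul_div_left _ _ hp.pos, Nat.add_mul_div_left _ _ hp.pos, Nat.mod_eq_of_lt h2t,
      Nat.mod_eq_of_lt (by lia : t < p), Nat.div_eq_of_lt h2t, Nat.div_eq_of_lt (by lia : t < p),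
      zero_add, zero_add] at hlucas
    rw [e1, hmn, (hlucas.dvd_iff dvd_rfl), hp.dvd_mul]
    rintro (h | h)
    · have hd : p ∣ (2 * t).factorial := by
        rw [← Nat.choose_mul_factorial_mul_factorial (by lia : t ≤ 2 * t)]
        exact (h.mul_right _).mul_right _
      have := (hp.dvd_factorial).mp hd
      lia
    · exact ih hn h

/-- Descent: `-1` is not a square mod `p`, so `p` divides both `x` and `y`, and `p ^ 2` can be
cancelled. -/
theorem eq_zero_or_eq_zero_of_sq_add_sq_eq_pow {p : ℕ} (hp : p.Prime) (hp3 : p % 4 = 3) {r : ℕ}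
    {x y : ℤ} (h : (p : ℤ) ^ r = x ^ 2 + y ^ 2) : x = 0 ∨ y = 0 := by
  induction r using Nat.strong_induction_on generalizing x y with
  | _ r ih =>
    rcases Nat.eq_zero_or_pos r with rfl | hr
    · rw [pow_zero] at h
      by_contra! h0
      have := sq_pos_of_ne_zero h0.1
      have := sq_pos_of_ne_zero h0.2
      lia
    · have : Fact p.Prime := ⟨hp⟩
      have hpz : Prime (p : ℤ) := Nat.prime_iff_prime_int.mp hp
      have hy : (p : ℤ) ∣ y := by
        by_contra hy
        have hz : (y : ZMod p) ≠ 0 := by rwa [Ne, ZMod.intCast_zmod_eq_zero_iff_dvd]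
        have h0 : (x : ZMod p) ^ 2 + (y : ZMod p) ^ 2 = 0 := by
          have := congrArg (Int.cast : ℤ → ZMod p) h
          push_cast at this
          rw [← this, ZMod.natCast_self, zero_pow hr.ne']
        refine ZMod.exists_sq_eq_neg_one_iff.mp ⟨(x : ZMod p) / (y : ZMod p), ?_⟩ hp3
        field_simp
        linear_combination -h0
      have hx : (p : ℤ) ∣ x := by
        apply hpz.dvd_of_dvd_pow (n := 2)
        rw [show x ^ 2 = (p : ℤ) ^ r - y ^ 2 by linear_combination -h]
        exact dvd_sub (dvd_pow_self _ hr.ne') (dvd_pow hy two_ne_zero)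
      obtain ⟨x, rfl⟩ := hx
      obtain ⟨y, rfl⟩ := hy
      have hp0 : (p : ℤ) ≠ 0 := hpz.ne_zero
      obtain ⟨s, rfl⟩ : ∃ s, r = s + 2 := by
        refine ⟨r - 2, ?_⟩
        by_contra hlt
        have : r = 1 := by lia
        subst this
        have h1 : (p : ℤ) * 1 = p * (p * (x ^ 2 + y ^ 2)) := by linear_combination h
        have h2 := mul_left_cancel₀ hp0 h1
        exact hpz.not_dvd_one ⟨_, h2⟩
      have h1 : (p : ℤ) ^ s = x ^ 2 + y ^ 2 := by
        have : (p : ℤ) ^ 2 * (p : ℤ) ^ s = (p : ℤ) ^ 2 * (x ^ 2 + y ^ 2) := by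
          linear_combination h
        exact mul_left_cancel₀ (pow_ne_zero _ hp0) this
      rcases ih s (by lia) h1 with rfl | rfl <;> simp

/-- `p` is inert in the Eisenstein integers. In the descent, `p ∤ y` would make `-x / y` an element
of order `3` in `ZMod p`, although `3 ∤ p - 1`. -/
theorem exists_of_sq_sub_mul_add_sq_eq_pow {p : ℕ} (hp : p.Prime) (hp2 : p % 3 = 2) {r : ℕ}
    {x y : ℤ} (h : (p : ℤ) ^ r = x ^ 2 - x * y + y ^ 2) :
    ∃ s : ℕ, ∃ u v : ℤ, r = 2 * s ∧ x = p ^ s * u ∧ y = p ^ s * v ∧ u ^ 2 - u * v + v ^ 2 = 1 := by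
  induction r using Nat.strong_induction_on generalizing x y with
  | _ r ih =>
    rcases Nat.eq_zero_or_pos r with rfl | hr
    · exact ⟨0, x, y, by simp, by simp, by simp, by simpa using h.symm⟩
    · have : Fact p.Prime := ⟨hp⟩
      have hpz : Prime (p : ℤ) := Nat.prime_iff_prime_int.mp hp
      have hy : (p : ℤ) ∣ y := by
        by_contra hy
        have hz : (y : ZMod p) ≠ 0 := by rwa [Ne, ZMod.intCast_zmod_eq_zero_iff_dvd]
        have h0 : (x : ZMod p) ^ 2 - x * y + (y : ZMod p) ^ 2 = 0 := by
          have := congrArg (Int.cast : ℤ → ZMod p) h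
          push_cast at this
          rw [← this, ZMod.natCast_self, zero_pow hr.ne']
        obtain ⟨w, hw⟩ : ∃ w : ZMod p, w = -(x : ZMod p) / (y : ZMod p) := ⟨_, rfl⟩
        have hw2 : w ^ 2 + w + 1 = 0 := by
          rw [hw]
          field_simp
          linear_combination h0
        have hw3 : w ^ 3 = 1 := by linear_combination (w - 1) * hw2
        have hw1 : w ≠ 1 := by
          rintro rfl
          have h3 : ((3 : ℕ) : ZMod p) = 0 := by
            push_cast
            linear_combination hw2
          rw [ZMod.natCast_eq_zero_iff, Nat.prime_dvd_prime_iff_eq hp Nat.prime_three] at h3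
          lia
        have hw0 : w ≠ 0 := by
          rintro rfl
          simp at hw2
        have ho : orderOf w = 3 := orderOf_eq_prime hw3 hw1
        have hd : 3 ∣ p - 1 := by
          rw [← ho]
          exact orderOf_dvd_of_pow_eq_one (ZMod.pow_card_sub_one_eq_one hw0)
        have := hp.pos
        lia
      have hx : (p : ℤ) ∣ x := by
        apply hpz.dvd_of_dvd_pow (n := 2)
        rw [show x ^ 2 = (p : ℤ) ^ r - y * (y - x) by linear_combination -h]
        exact dvd_sub (dvd_pow_self _ hr.ne') (hy.mul_right _)
      obtain ⟨x, rfl⟩ := hx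
      obtain ⟨y, rfl⟩ := hy
      have hp0 : (p : ℤ) ≠ 0 := hpz.ne_zero
      obtain ⟨s, rfl⟩ : ∃ s, r = s + 2 := by
        refine ⟨r - 2, ?_⟩
        by_contra hlt
        have : r = 1 := by lia
        subst this
        have h1 : (p : ℤ) * 1 = p * (p * (x ^ 2 - x * y + y ^ 2)) := by linear_combination h
        have h2 := mul_left_cancel₀ hp0 h1
        exact hpz.not_dvd_one ⟨_, h2⟩
      have h1 : (p : ℤ) ^ s = x ^ 2 - x * y + y ^ 2 := by
        have : (p : ℤ) ^ 2 * (p : ℤ) ^ s = (p : ℤ) ^ 2 * (x ^ 2 - x * y + y ^ 2) := by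
          linear_combination h
        exact mul_left_cancel₀ (pow_ne_zero _ hp0) this
      obtain ⟨s', u, v, hs, rfl, rfl, huv⟩ := ih s (by lia) h1
      exact ⟨s' + 1, u, v, by lia, by ring, by ring, huv⟩

end Arithmetic

/-! ### Reduction from the local ring to its residue field. -/

section LocalRing

open Finset

variable {R : Type*} [CommRing R] [IsLocalRing R]

open IsLocalRing

theorem card_residue_preimage (S : Set (ResidueField R)) :
    Nat.card (residue R ⁻¹' S) = Nat.card (maximalIdeal R) * Nat.card S := by
  rw [← Nat.card_prod]
  exact Nat.card_congr
    (QuotientAddGroup.preimageMkEquivAddSubgroupProdSet (maximalIdeal R).toAddSubgroup S)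

theorem card_eq_card_maximalIdeal_mul :
    Nat.card R = Nat.card (maximalIdeal R) * Nat.card (ResidueField R) := by
  have := card_residue_preimage (R := R) Set.univ
  rwa [Set.preimage_univ, Nat.card_univ, Nat.card_univ] at this

theorem card_ker_units_map_residue :
    Nat.card (Units.map (residue R : R →* ResidueField R)).ker = Nat.card (maximalIdeal R) := by
  refine Nat.card_congr (Equiv.ofBijective (fun u ↦ ⟨(u : Rˣ) - 1, ?_⟩) ⟨?_, ?_⟩)
  · rw [← residue_eq_zero_iff, map_sub, map_one, sub_eq_zero]
    exact congrArg Units.val u.2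
  · intro u v huv
    have := congrArg Subtype.val huv
    exact Subtype.ext (Units.ext (sub_left_injective this))
  · intro x
    have hx : IsUnit (1 + (x : R)) := by
      rw [← residue_ne_zero_iff_isUnit, map_add, (residue_eq_zero_iff _).mpr x.2]
      simp
    refine ⟨⟨hx.unit, ?_⟩, ?_⟩
    · rw [MonoidHom.mem_ker]
      ext
      simp [(residue_eq_zero_iff _).mpr x.2]
    · simp

/-- When `k` is prime to the order of the maximal ideal, being a `k`-th power of a unit can be
tested in the residue field. -/
theorem mem_unitPowers_iff_residue_mem {k : ℕ} (hk : (Nat.card (maximalIdeal R)).Coprime k)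
    (y : R) : y ∈ unitPowers R k ↔ residue R y ∈ unitPowers (ResidueField R) k := by
  constructor
  · rintro ⟨x, rfl⟩
    exact ⟨Units.map (residue R : R →* ResidueField R) x, by simp⟩
  · intro hres
    have hy : IsUnit y := by
      rw [← residue_ne_zero_iff_isUnit]
      exact ne_zero_of_mem_unitPowers hres
    obtain ⟨z, hz⟩ := hres
    obtain ⟨x, rfl⟩ := surjective_units_map_of_local_ringHom (residue R) residue_surjective
      inferInstance z
    rw [← card_ker_units_map_residue] at hk
    have hker : hy.unit * (x ^ k)⁻¹ ∈ (Units.map (residue R : R →* ResidueField R)).ker := by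
      rw [MonoidHom.mem_ker, map_mul, map_inv, mul_inv_eq_one]
      ext
      simpa using hz
    -- The kernel `1 + 𝔪` has order `|𝔪|`, prime to `k`, so each of its elements is a `k`-th power.
    obtain ⟨w, hw⟩ := (powCoprime hk).surjective ⟨_, hker⟩
    have hw' : (w : Rˣ) ^ k = hy.unit * (x ^ k)⁻¹ := congrArg Subtype.val hw
    refine ⟨w * x, ?_⟩
    have : hy.unit = ((w : Rˣ) * x) ^ k := by
      rw [mul_pow, hw', inv_mul_cancel_right]
    simpa using congrArg Units.val this

theorem cyclotomicCount_eq_card_maximalIdeal_mul {k : ℕ}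
    (hk : (Nat.card (maximalIdeal R)).Coprime k) :
    cyclotomicCount R k k =
      Nat.card (maximalIdeal R) * cyclotomicCount (ResidueField R) k k := by
  rw [cyclotomicCount, cyclotomicCount, ← card_residue_preimage]
  congr!
  simp only [mem_unitPowers_iff_residue_mem hk, map_sub, map_one]
  rfl

theorem card_unitPowers_eq_card_maximalIdeal_mul {k : ℕ}
    (hk : (Nat.card (maximalIdeal R)).Coprime k) :
    Nat.card (unitPowers R k) =
      Nat.card (maximalIdeal R) * Nat.card (unitPowers (ResidueField R) k) := by
  rw [← card_residue_preimage]
  congr!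
  ext y
  exact mem_unitPowers_iff_residue_mem hk y

end LocalRing

/-! ### Triangles in the Cayley graph. -/

section Graph

open Finset

theorem six_mul_numCliques_three {V : Type*} [Finite V] (G : SimpleGraph V) :
    6 * numCliques 3 G = Nat.card {f : Fin 3 → V // ∀ i j, i ≠ j → G.Adj (f i) (f j)} := by
  classical
  have hcard : ∀ s : {s : Finset V // G.IsNClique 3 s}, Nat.card (Fin 3 ≃ s.1) = 6 := by
    intro s
    have e : Fin 3 ≃ s.1 := (Fintype.equivFinOfCardEq (by simpa using s.2.card_eq)).symm
    rw [Nat.card_eq_fintype_card, Fintype.card_equiv e]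
    rfl
  have hsig : 6 * numCliques 3 G =
      Nat.card (Σ s : {s : Finset V // G.IsNClique 3 s}, (Fin 3 ≃ s.1)) := by
    have := Fintype.ofFinite {s : Finset V // G.IsNClique 3 s}
    rw [Nat.card_sigma, sum_congr rfl fun s _ ↦ hcard s, sum_const, card_univ, smul_eq_mul,
      mul_comm, numCliques, Nat.card_eq_fintype_card]
  rw [hsig]
  refine Nat.card_congr (Equiv.ofBijective (fun x ↦ ⟨fun i ↦ (x.2 i : V), ?_⟩) ⟨?_, ?_⟩)
  · intro i j hij
    exact x.1.2.isClique (x.2 i).2 (x.2 j).2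
      fun h ↦ hij (x.2.injective (Subtype.ext h))
  · rintro ⟨⟨s, hs⟩, e⟩ ⟨⟨t, ht⟩, e'⟩ h
    have h : ∀ i, (e i : V) = e' i := congrFun (congrArg Subtype.val h)
    have hst : s = t := by
      ext v
      constructor
      · intro hv
        have := h (e.symm ⟨v, hv⟩)
        rw [Equiv.apply_symm_apply] at this
        change v = _ at this
        rw [this]
        exact (e' _).2
      · intro hv
        have := h (e'.symm ⟨v, hv⟩)
        rw [Equiv.apply_symm_apply] at this
        change _ = v at this
        rw [← this]
        exact (e _).2
    subst hst
    have : e = e' := Equiv.ext fun i ↦ Subtype.ext (h i)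
    rw [this]
  · rintro ⟨f, hf⟩
    have hinj : Function.Injective f := by
      intro i j hij
      by_contra hne
      exact (hf i j hne).ne hij
    refine ⟨⟨⟨univ.map ⟨f, hinj⟩, ?_, ?_⟩, ?_⟩, ?_⟩
    · intro x hx y hy hxy
      simp only [coe_map, Function.Embedding.coeFn_mk, coe_univ, Set.image_univ,
        Set.mem_range] at hx hy
      obtain ⟨i, rfl⟩ := hx
      obtain ⟨j, rfl⟩ := hy
      exact hf i j fun h ↦ hxy (congrArg f h)
    · simp
    · exact (Equiv.ofBijective (fun i ↦ ⟨f i, by simp⟩) ⟨fun i j h ↦ hinj (congrArg Subtype.val h),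
        fun ⟨v, hv⟩ ↦ by
          obtain ⟨i, _, rfl⟩ := mem_map.mp hv
          exact ⟨i, rfl⟩⟩)
    · rfl

theorem neg_mem_unitPowers {R : Type*} [CommRing R] {k : ℕ} (h : (-1 : R) ∈ unitPowers R k)
    {y : R} (hy : y ∈ unitPowers R k) : -y ∈ unitPowers R k := by
  obtain ⟨a, ha⟩ := h
  obtain ⟨b, rfl⟩ := hy
  exact ⟨a * b, by rw [Units.val_mul, mul_pow, ← ha, neg_one_mul]⟩

theorem mul_mem_unitPowers_iff {R : Type*} [CommRing R] {k : ℕ} {y w : R}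
    (hy : y ∈ unitPowers R k) : y * w ∈ unitPowers R k ↔ w ∈ unitPowers R k := by
  obtain ⟨b, rfl⟩ := hy
  constructor
  · rintro ⟨a, ha⟩
    refine ⟨b⁻¹ * a, ?_⟩
    rw [Units.val_mul, mul_pow, ← ha, ← mul_assoc, ← mul_pow, Units.inv_mul, one_pow, one_mul]
  · rintro ⟨a, rfl⟩
    exact ⟨b * a, by rw [Units.val_mul, mul_pow]⟩

theorem unitaryCayley_adj {R : Type*} [CommRing R] [Nontrivial R] {k : ℕ}
    (h : (-1 : R) ∈ unitPowers R k) (v w : R) :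
    (unitaryCayley R k).Adj v w ↔ w - v ∈ unitPowers R k := by
  rw [unitaryCayley, SimpleGraph.addCayley_adj']
  constructor
  · rintro ⟨-, g, hg, rfl | rfl⟩
    · simpa using hg
    · simpa using neg_mem_unitPowers h hg
  · intro hvw
    refine ⟨?_, w - v, hvw, Or.inl (by ring)⟩
    rintro rfl
    obtain ⟨x, hx⟩ := hvw
    rw [sub_self] at hx
    exact (x.isUnit.pow k).ne_zero hx.symm

/-- An ordered triangle is uniquely `(a, a + y, a + y * w)` with `y`, `w` and `1 - w` in `U_R(k)`.
-/
theorem six_mul_numCliques_three_unitaryCayley {R : Type*} [CommRing R] [Finite R] [Nontrivial R]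
    {k : ℕ} (h : (-1 : R) ∈ unitPowers R k) :
    6 * numCliques 3 (unitaryCayley R k) =
      Nat.card R * Nat.card (unitPowers R k) * cyclotomicCount R k k := by
  rw [six_mul_numCliques_three, cyclotomicCount, ← Nat.card_prod, ← Nat.card_prod]
  simp only [unitaryCayley_adj h]
  have hneg : ∀ x y : R, x - y ∈ unitPowers R k → y - x ∈ unitPowers R k := by
    intro x y hxy
    simpa using neg_mem_unitPowers h hxy
  symm
  refine Nat.card_congr (Equiv.ofBijective
    (fun t ↦ ⟨![t.1.1, t.1.1 + t.1.2, t.1.1 + t.1.2 * t.2], ?_⟩) ⟨?_, ?_⟩)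
  · obtain ⟨⟨a, y, hy⟩, w, hw, hw'⟩ := t
    have h01 : (a + y) - a ∈ unitPowers R k := by simpa using hy
    have h02 : (a + y * w) - a ∈ unitPowers R k := by
      simpa using (mul_mem_unitPowers_iff hy).mpr hw
    have h21 : (a + y) - (a + y * w) ∈ unitPowers R k := by
      rw [show (a + y) - (a + y * w) = y * (1 - w) by ring]
      exact (mul_mem_unitPowers_iff hy).mpr hw'
    intro i j hij
    fin_cases i <;> fin_cases j
    · exact absurd rfl hij
    · exact h01
    · exact h02
    · exact hneg _ _ h01
    · exact absurd rfl hij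
    · exact hneg _ _ h21
    · exact hneg _ _ h02
    · exact h21
    · exact absurd rfl hij
  · rintro ⟨⟨a, y, hy⟩, w, hw⟩ ⟨⟨a', y', hy'⟩, w', hw'⟩ hEq
    have hEq := congrArg Subtype.val hEq
    have h0 : a = a' := congrFun hEq 0
    subst h0
    have h1 : a + y = a + y' := congrFun hEq 1
    have h1 := add_left_cancel h1
    subst h1
    have h2 : a + y * w = a + y * w' := congrFun hEq 2
    have h2 := add_left_cancel h2
    obtain ⟨x, rfl⟩ := hy
    have h2 := (x.isUnit.pow k).mul_left_cancel h2
    subst h2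
    rfl
  · rintro ⟨f, hf⟩
    have h01 := hf 0 1 (by decide)
    have h02 := hf 0 2 (by decide)
    have h21 := hf 2 1 (by decide)
    obtain ⟨x, hx⟩ := id h01
    have hw : f 2 - f 0 = (f 1 - f 0) * (((x⁻¹ : Rˣ) : R) ^ k * (f 2 - f 0)) := by
      rw [hx, ← mul_assoc, ← mul_pow, Units.mul_inv, one_pow, one_mul]
    have hw' : f 1 - f 2 =
        (f 1 - f 0) * (1 - ((x⁻¹ : Rˣ) : R) ^ k * (f 2 - f 0)) := by
      linear_combination -hw
    refine ⟨⟨⟨f 0, f 1 - f 0, h01⟩, ((x⁻¹ : Rˣ) : R) ^ k * (f 2 - f 0), ?_, ?_⟩, ?_⟩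
    · rwa [← mul_mem_unitPowers_iff h01, ← hw]
    · rwa [← mul_mem_unitPowers_iff h01, ← hw']
    · ext i
      fin_cases i
      · rfl
      · simp
      · change f 0 + (f 1 - f 0) * (((x⁻¹ : Rˣ) : R) ^ k * (f 2 - f 0)) = f 2
        rw [← hw]
        ring

end Graph

/-! ### Identification of the integers `c` and `e`. -/

section Evaluation

open Finset

variable {F : Type*} [Field F] [Fintype F]

theorem neg_one_mem_unitPowers {k m : ℕ} (h : Fintype.card F - 1 = k * m) (hm : Even m) :
    (-1 : F) ∈ unitPowers F k := by
  rw [mem_unitPowers_iff_pow_eq_one h, hm.neg_one_pow]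

theorem three_dvd_of_nine_mul_eq {q m a b N : ℤ} (hab : q = a ^ 2 - a * b + b ^ 2)
    (hq : q = 3 * m + 1) (hN : 9 * N = q - 8 + (2 * a - b)) : 3 ∣ b := by
  apply Int.prime_three.dvd_of_dvd_pow (n := 2)
  -- The witness is `(4 * q - c ^ 2) / 9` with `c = 2 * a - b = 9 * N - 3 * m + 7`, since `4 * q = c
  -- ^ 2 + 3 * b ^ 2`.
  refine ⟨6 * m - 5 - (3 * N - m) ^ 2 - 14 * N, ?_⟩
  have hc : 2 * a - b = 9 * N - 3 * m + 7 := by linear_combination -hN - hq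
  have h4 : 4 * (3 * m + 1) = (2 * a - b) ^ 2 + 3 * b ^ 2 := by
    rw [← hq, hab]
    ring
  rw [hc] at h4
  have : 3 * b ^ 2 = 3 * (3 * (6 * m - 5 - (3 * N - m) ^ 2 - 14 * N)) := by
    linear_combination -h4
  exact mul_left_cancel₀ three_ne_zero this

theorem exists_cyclotomicCount_three_three_of_modEq_one {p r m : ℕ} (hp : p.Prime)
    (hF : Fintype.card F = p ^ r) (h : Fintype.card F - 1 = 3 * m) (hm : Even m)
    (hp1 : p ≡ 1 [MOD 3]) :
    ∃ c d : ℤ, 4 * (Fintype.card F : ℤ) = c ^ 2 + 27 * d ^ 2 ∧ c ≡ 1 [ZMOD 3] ∧ ¬ (p : ℤ) ∣ c ∧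
      9 * (cyclotomicCount F 3 3 : ℤ) = Fintype.card F - 8 + c := by
  have : Fact p.Prime := ⟨hp⟩
  have : CharP F p := charP_of_card_eq_prime_pow hF
  have hcard := Fintype.one_lt_card (α := F)
  obtain ⟨a, b, hab, hN⟩ := exists_nine_mul_cyclotomicCount_three_three (F := F) ⟨m, h⟩
  have hq : (Fintype.card F : ℤ) = 3 * m + 1 := by lia
  have hb := three_dvd_of_nine_mul_eq hab hq hN
  obtain ⟨d, rfl⟩ := hb
  refine ⟨2 * a - 3 * d, d, ?_, ?_, ?_, hN⟩
  · rw [hab]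
    ring
  · rw [Int.modEq_iff_dvd]
    exact ⟨m - 2 - 3 * (cyclotomicCount F 3 3 : ℤ), by linear_combination hN + hq⟩
  -- In `F` the two evaluations of the count give `c = -(2m).choose m`, which is nonzero.
  · intro hdvd
    have hN' := congrArg (Int.cast : ℤ → F) hN
    rw [Int.cast_add, (CharP.intCast_eq_zero_iff F p _).mpr hdvd] at hN'
    push_cast at hN'
    rw [nine_mul_cyclotomicCount_three_three_cast h hm, FiniteField.cast_card_eq_zero] at hN'
    have h0 : ((2 * m).choose m : F) = 0 := by linear_combination -hN'
    rw [CharP.cast_eq_zero_iff F p] at h0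
    obtain ⟨t, ht⟩ := (Nat.modEq_iff_dvd' hp.one_lt.le).mp hp1.symm
    have := hp.one_lt
    exact hp.not_dvd_choose_two_mul (k := 3) (t := t) (r := r) (by norm_num) (by lia)
      (by lia) h0

/-- The Jacobi sum is `p ^ s` times an Eisenstein unit `u + v * ω`. Here `3 ∣ b` forces `v = 0`, and
`(-p) ^ s ≡ 1 (mod 3)` together with `9 ∣ q - 8 + c` fixes the sign. -/
theorem cyclotomicCount_three_three_of_modEq_two {p r : ℕ} (hp : p.Prime)
    (hF : Fintype.card F = p ^ r) (h3 : 3 ∣ Fintype.card F - 1) (hp2 : p ≡ 2 [MOD 3]) :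
    9 * (cyclotomicCount F 3 3 : ℤ) = Fintype.card F - 8 + -2 * (-(p : ℤ)) ^ (r / 2) := by
  have hcard := Fintype.one_lt_card (α := F)
  obtain ⟨a, b, hab, hN⟩ := exists_nine_mul_cyclotomicCount_three_three (F := F) h3
  obtain ⟨m, hm⟩ := h3
  have hq : (Fintype.card F : ℤ) = 3 * m + 1 := by lia
  have hab' : (p : ℤ) ^ r = a ^ 2 - a * b + b ^ 2 := by
    rw [← hab, hF]
    push_cast
    rfl
  obtain ⟨s, u, v, rfl, rfl, rfl, huv⟩ := exists_of_sq_sub_mul_add_sq_eq_pow hp hp2 hab'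
  rw [Nat.mul_div_cancel_left _ two_pos]
  obtain ⟨ε, hε, hε'⟩ : ∃ ε : ℤ, (p : ℤ) ^ s = (-p) ^ s * ε ∧ (ε = 1 ∨ ε = -1) := by
    rcases Nat.even_or_odd s with hs | hs
    · exact ⟨1, by rw [hs.neg_pow, mul_one], Or.inl rfl⟩
    · exact ⟨-1, by rw [hs.neg_pow, neg_mul_neg, mul_one], Or.inr rfl⟩
  have hmod : (3 : ℤ) ∣ (-p) ^ s - 1 := by
    have h1 : (-p : ℤ) ≡ 1 [ZMOD 3] := by
      have : p % 3 = 2 := hp2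
      rw [Int.modEq_iff_dvd]
      lia
    have := (h1.pow s).symm
    rw [one_pow] at this
    exact this.dvd
  obtain ⟨w, hw⟩ := hmod
  have hps : (p : ℤ) ^ s = (1 + 3 * w) * ε := by rw [hε]; linear_combination ε * hw
  have hsmall : 0 ≤ (2 * u - v) ^ 2 := sq_nonneg _
  have hv : v ≤ 1 := by nlinarith
  have hv' : -1 ≤ v := by nlinarith
  have hb := three_dvd_of_nine_mul_eq hab hq hN
  have h3v : 3 ∣ v := by
    refine (Int.prime_three.dvd_or_dvd hb).resolve_left fun h3 ↦ ?_
    rw [hps] at h3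
    rcases hε' with rfl | rfl <;> lia
  have hv0 : v = 0 := by lia
  subst hv0
  have hu : u = 1 ∨ u = -1 := by
    refine sq_eq_sq_iff_eq_or_eq_neg.mp ?_
    linear_combination huv
  rw [hN, hε]
  rw [hps] at hN
  rcases hε' with rfl | rfl <;> rcases hu with rfl | rfl
  · lia
  · ring
  · ring
  · lia

theorem exists_cyclotomicCount_four_four {p r m : ℕ} (hp : p.Prime)
    (hF : Fintype.card F = p ^ r) (h : Fintype.card F - 1 = 4 * m) (hm : Even m) :
    ∃ e f : ℤ, (Fintype.card F : ℤ) = e ^ 2 + 4 * f ^ 2 ∧ e ≡ 1 [ZMOD 4] ∧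
      (p ≡ 1 [MOD 4] → ¬ (p : ℤ) ∣ e) ∧
      16 * (cyclotomicCount F 4 4 : ℤ) = Fintype.card F - 11 - 6 * e := by
  have : Fact p.Prime := ⟨hp⟩
  have : CharP F p := charP_of_card_eq_prime_pow hF
  have hcard := Fintype.one_lt_card (α := F)
  obtain ⟨a, b, hab, hN, hM⟩ := exists_sixteen_mul_cyclotomicCount_four_four (F := F) ⟨m, h⟩
    (neg_one_mem_unitPowers h hm)
  obtain ⟨n, hn⟩ := id hm
  have hq : (Fintype.card F : ℤ) = 8 * n + 1 := by lia
  -- From `hM` and `q = 8 * n + 1`, `2 * a ≡ 6 (mod 8)`; hence the choice `e = -a` below.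
  have ha : a % 4 = 3 := by lia
  have hb : (2 : ℤ) ∣ b := by
    by_contra hb
    obtain ⟨y, hy⟩ : ∃ y, b = 2 * y + 1 := ⟨b / 2, by lia⟩
    obtain ⟨x, hx⟩ : ∃ x, a = 2 * x + 1 := ⟨a / 2, by lia⟩
    have : (8 * n + 1 : ℤ) = 2 * (2 * x ^ 2 + 2 * x + 2 * y ^ 2 + 2 * y + 1) := by
      rw [← hq, hab, hx, hy]
      ring
    lia
  obtain ⟨f, rfl⟩ := hb
  refine ⟨-a, f, by rw [hab]; ring, ?_, ?_, by rw [hN]; ring⟩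
  · rw [Int.modEq_iff_dvd]
    lia
  · intro hp1 hdvd
    rw [dvd_neg] at hdvd
    have hM' := congrArg (Int.cast : ℤ → F) hM
    rw [Int.cast_add, (CharP.intCast_eq_zero_iff F p _).mpr (hdvd.mul_left 2)] at hM'
    push_cast at hM'
    rw [eight_mul_cyclotomicCount_four_two_cast h hm, FiniteField.cast_card_eq_zero] at hM'
    have h0 : ((2 * m).choose m : F) = 0 := by linear_combination -hM'
    rw [CharP.cast_eq_zero_iff F p] at h0
    obtain ⟨t, ht⟩ := (Nat.modEq_iff_dvd' hp.one_lt.le).mp hp1.symm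
    have := hp.one_lt
    exact hp.not_dvd_choose_two_mul (k := 4) (t := t) (r := r) (by norm_num) (by lia)
      (by lia) h0

/-- The integer `c` in a normalized primitive representation `4 * p ^ r = c ^ 2 + 27 * d ^ 2`
is unique. -/
theorem eq_of_four_mul_pow_eq {p r : ℕ} (hp : p.Prime) (hp1 : p ≡ 1 [MOD 3]) (hr : r ≠ 0)
    {c d c' d' : ℤ} (h : 4 * (p : ℤ) ^ r = c ^ 2 + 27 * d ^ 2)
    (h' : 4 * (p : ℤ) ^ r = c' ^ 2 + 27 * d' ^ 2) (hc : c ≡ 1 [ZMOD 3]) (hc' : c' ≡ 1 [ZMOD 3])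
    (hpc : ¬ (p : ℤ) ∣ c) (hpc' : ¬ (p : ℤ) ∣ c') : c = c' := by
  have hp2 : p ≠ 2 := by
    rintro rfl
    exact absurd hp1 (by decide)
  have hsq := sq_eq_sq_of_add_mul_sq_eq hp hp2 hr (by norm_num) (by norm_num) h h' hpc hpc'
  rcases sq_eq_sq_iff_eq_or_eq_neg.mp hsq with h | h
  · exact h
  · rw [Int.ModEq] at hc hc'
    lia

/-- The integer `e` in a normalized representation `p ^ r = e ^ 2 + 4 * f ^ 2`, primitive
when `p ≡ 1 (mod 4)`, is unique. -/
theorem eq_of_pow_eq_sq_add_four_mul_sq {p r : ℕ} (hp : p.Prime) (hp2 : p ≠ 2) (hr : r ≠ 0)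
    {e f e' f' : ℤ} (h : (p : ℤ) ^ r = e ^ 2 + 4 * f ^ 2)
    (h' : (p : ℤ) ^ r = e' ^ 2 + 4 * f' ^ 2) (he : e ≡ 1 [ZMOD 4]) (he' : e' ≡ 1 [ZMOD 4])
    (hpe : p ≡ 1 [MOD 4] → ¬ (p : ℤ) ∣ e) (hpe' : p ≡ 1 [MOD 4] → ¬ (p : ℤ) ∣ e') : e = e' := by
  rw [Int.ModEq] at he he'
  have hsq : e ^ 2 = e' ^ 2 := by
    by_cases hp1 : p ≡ 1 [MOD 4]
    · exact sq_eq_sq_of_add_mul_sq_eq hp hp2 hr (n := 1) (D := 4) (by norm_num) (by norm_num)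
        (by rw [one_mul, h]) (by rw [one_mul, h']) (hpe hp1) (hpe' hp1)
    · have hp3 : p % 4 = 3 := by
        have := hp.eq_two_or_odd
        rw [Nat.ModEq] at hp1
        lia
      -- For `p ≡ 3 (mod 4)` one of the two squares vanishes; it is not `x ^ 2`, as `x` is odd.
      have key : ∀ {x y : ℤ}, (p : ℤ) ^ r = x ^ 2 + 4 * y ^ 2 → x % 4 = 1 % 4 →
          x ^ 2 = (p : ℤ) ^ r := by
        intro x y hxy hx
        have hxy' : (p : ℤ) ^ r = x ^ 2 + (2 * y) ^ 2 := by rw [hxy]; ring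
        rcases eq_zero_or_eq_zero_of_sq_add_sq_eq_pow hp hp3 hxy' with h0 | h0
        · lia
        · rw [hxy', h0]
          ring
      rw [key h he, key h' he']
  rcases sq_eq_sq_iff_eq_or_eq_neg.mp hsq with h | h
  · exact h
  · lia

end Evaluation

/-! ### The triangle count in terms of the residue field, and the three cases. -/

section Triangles

open IsLocalRing

theorem numCliques_three_unitaryCayley {R : Type*} [CommRing R] [Finite R] [IsLocalRing R]
    {q β k m : ℕ} (hq : Nat.card (ResidueField R) = q)
    (hm : Nat.card (maximalIdeal R) = q ^ β) (hk : k ≠ 0) (hqm : q - 1 = k * m)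
    (hneg : (-1 : ResidueField R) ∈ unitPowers (ResidueField R) k) :
    (numCliques 3 (unitaryCayley R k) : ℚ) =
      (q : ℚ) ^ (3 * β + 1) * ((q : ℚ) - 1) * cyclotomicCount (ResidueField R) k k / (6 * k) := by
  have : Finite (ResidueField R) := Finite.of_surjective _ residue_surjective
  have : Fintype (ResidueField R) := Fintype.ofFinite _
  have hcard := Fintype.one_lt_card (α := ResidueField R)
  rw [← Nat.card_eq_fintype_card, hq] at hcard
  have hcop : (Nat.card (maximalIdeal R)).Coprime k := by
    rw [hm]
    apply Nat.Coprime.pow_left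
    rw [show q = k * m + 1 by lia]
    simp
  have hnegR : (-1 : R) ∈ unitPowers R k := by
    rw [mem_unitPowers_iff_residue_mem hcop]
    simpa using hneg
  have h := six_mul_numCliques_three_unitaryCayley hnegR
  rw [card_eq_card_maximalIdeal_mul, card_unitPowers_eq_card_maximalIdeal_mul hcop,
    cyclotomicCount_eq_card_maximalIdeal_mul hcop, hm, hq,
    card_unitPowers (m := m) (by rw [← Nat.card_eq_fintype_card, hq, hqm]) hk] at h
  have h' : (6 * numCliques 3 (unitaryCayley R k) : ℚ) =
      (q : ℚ) ^ β * q * (q ^ β * m) * (q ^ β * cyclotomicCount (ResidueField R) k k) := by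
    exact_mod_cast h
  have hq1 : (q : ℚ) - 1 = k * m := by
    have : q = k * m + 1 := by lia
    rw [this]
    push_cast
    ring
  have hk0 : (k : ℚ) ≠ 0 := Nat.cast_ne_zero.mpr hk
  rw [eq_div_iff (by positivity), hq1]
  linear_combination (k : ℚ) * h'

end Triangles

theorem theorem3p1 {R : Type*} [CommRing R] [Finite R] [IsLocalRing R] (q β : ℕ)
    (hq : Nat.card (IsLocalRing.ResidueField R) = q)
    (hm : Nat.card (IsLocalRing.maximalIdeal R) = q ^ β) :
    -- `k = 2`
    (q ≡ 1 [MOD 4] →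
      (numCliques 3 (unitaryCayley R 2) : ℚ) =
        (q : ℚ) ^ (3 * β + 1) * ((q : ℚ) - 1) * ((q : ℚ) - 5) / 48) ∧
    -- `k = 3`
    (∀ p r : ℕ, p.Prime → q = p ^ r →
      (Even q → (3 : ℤ) ∣ (q : ℤ) - 1) → (Odd q → (6 : ℤ) ∣ (q : ℤ) - 1) →
      (p ≡ 1 [MOD 3] →
        (∃ c d : ℤ, 4 * (q : ℤ) = c ^ 2 + 27 * d ^ 2 ∧ c ≡ 1 [ZMOD 3] ∧ ¬ (p : ℤ) ∣ c) ∧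
        ∀ c d : ℤ, 4 * (q : ℤ) = c ^ 2 + 27 * d ^ 2 → c ≡ 1 [ZMOD 3] → ¬ (p : ℤ) ∣ c →
          (numCliques 3 (unitaryCayley R 3) : ℚ) =
            (q : ℚ) ^ (3 * β + 1) * ((q : ℚ) - 1) * ((q : ℚ) + (c : ℚ) - 8) / 162) ∧
      -- here `r` is automatically even
      (p ≡ 2 [MOD 3] →
        ∀ c : ℤ, c = -2 * (-(p : ℤ)) ^ (r / 2) →
          (numCliques 3 (unitaryCayley R 3) : ℚ) =
            (q : ℚ) ^ (3 * β + 1) * ((q : ℚ) - 1) * ((q : ℚ) + (c : ℚ) - 8) / 162)) ∧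
    -- `k = 4`
    (∀ p r : ℕ, p.Prime → q = p ^ r → q ≡ 1 [MOD 8] →
      (∃ e f : ℤ, (q : ℤ) = e ^ 2 + 4 * f ^ 2 ∧ e ≡ 1 [ZMOD 4] ∧
        (p ≡ 1 [MOD 4] → ¬ (p : ℤ) ∣ e)) ∧
      ∀ e f : ℤ, (q : ℤ) = e ^ 2 + 4 * f ^ 2 → e ≡ 1 [ZMOD 4] →
        (p ≡ 1 [MOD 4] → ¬ (p : ℤ) ∣ e) →
        (numCliques 3 (unitaryCayley R 4) : ℚ) =
          (q : ℚ) ^ (3 * β + 1) * ((q : ℚ) - 1) * ((q : ℚ) - 6 * (e : ℚ) - 11)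
            / (2 ^ 7 * 3)) := by
  have : Finite (IsLocalRing.ResidueField R) :=
    Finite.of_surjective _ IsLocalRing.residue_surjective
  have : Fintype (IsLocalRing.ResidueField R) := Fintype.ofFinite _
  have hF : Fintype.card (IsLocalRing.ResidueField R) = q := by
    rw [← Nat.card_eq_fintype_card, hq]
  have hq1 : 1 < q := hF ▸ Fintype.one_lt_card
  have hr0 : ∀ {p r : ℕ}, q = p ^ r → r ≠ 0 := by
    rintro p r hqr rfl
    rw [pow_zero] at hqr
    exact hq1.ne' hqr
  refine ⟨fun hmod ↦ ?_, fun p r hp hqr heven hodd ↦ ?_, fun p r hp hqr hmod ↦ ?_⟩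
  · obtain ⟨n, hn⟩ : ∃ n, q - 1 = 2 * (2 * n) :=
      ⟨(q - 1) / 4, by rw [Nat.ModEq] at hmod; lia⟩
    have hneg := neg_one_mem_unitPowers (hF ▸ hn) (even_two_mul n)
    have hN := four_mul_cyclotomicCount_two_two (hF ▸ ⟨_, hn⟩) hneg
    rw [hF] at hN
    have hN' : (4 * cyclotomicCount (IsLocalRing.ResidueField R) 2 2 : ℚ) = q - 5 := by
      exact_mod_cast hN
    rw [numCliques_three_unitaryCayley hq hm two_ne_zero hn hneg, ← hN']
    push_cast
    ring
  · have h3 : ∃ m, q - 1 = 3 * m ∧ (Odd q → Even m) := by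
      rcases Nat.even_or_odd q with h | h
      · obtain ⟨m, hm⟩ := heven h
        exact ⟨m.toNat, by lia, fun h' ↦ absurd h (Nat.not_even_iff_odd.mpr h')⟩
      · obtain ⟨m, hm⟩ := hodd h
        exact ⟨2 * m.toNat, by lia, fun _ ↦ even_two_mul _⟩
    obtain ⟨m, hqm, hmeven⟩ := h3
    have hneg : (-1 : IsLocalRing.ResidueField R) ∈ unitPowers (IsLocalRing.ResidueField R) 3 :=
      ⟨-1, by norm_num⟩
    have hcount : ∀ c : ℤ,
        9 * (cyclotomicCount (IsLocalRing.ResidueField R) 3 3 : ℤ) = q - 8 + c →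
        (numCliques 3 (unitaryCayley R 3) : ℚ) =
          (q : ℚ) ^ (3 * β + 1) * ((q : ℚ) - 1) * ((q : ℚ) + (c : ℚ) - 8) / 162 := by
      intro c hN
      have hN' : (9 * cyclotomicCount (IsLocalRing.ResidueField R) 3 3 : ℚ) = q - 8 + c := by
        exact_mod_cast hN
      rw [numCliques_three_unitaryCayley hq hm three_ne_zero hqm hneg, add_sub_right_comm, ← hN']
      push_cast
      ring
    refine ⟨fun hp1 ↦ ?_, fun hp2 c hc ↦ ?_⟩
    · have hqodd : Odd q := by
        rw [hqr]
        refine (hp.odd_of_ne_two ?_).pow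
        rintro rfl
        exact absurd hp1 (by decide)
      obtain ⟨c, d, hcd, hc, hpc, hN⟩ := exists_cyclotomicCount_three_three_of_modEq_one hp
        (hF.trans hqr) (hF ▸ hqm) (hmeven hqodd) hp1
      rw [hF] at hcd hN
      refine ⟨⟨c, d, hcd, hc, hpc⟩, fun c' d' hcd' hc' hpc' ↦ ?_⟩
      have hqz : (q : ℤ) = (p : ℤ) ^ r := by exact_mod_cast hqr
      have hcc : c = c' := eq_of_four_mul_pow_eq hp hp1 (hr0 hqr) (hqz ▸ hcd) (hqz ▸ hcd') hc hc'
        hpc hpc'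
      exact hcount c' (hcc ▸ hN)
    · have hN := cyclotomicCount_three_three_of_modEq_two hp (hF.trans hqr) (hF ▸ ⟨m, hqm⟩) hp2
      rw [hF, ← hc] at hN
      exact hcount c hN
  · obtain ⟨n, hn⟩ : ∃ n, q - 1 = 4 * (2 * n) :=
      ⟨(q - 1) / 8, by rw [Nat.ModEq] at hmod; lia⟩
    have hneg := neg_one_mem_unitPowers (hF ▸ hn) (even_two_mul n)
    obtain ⟨e, f, hef, he, hpe, hN⟩ := exists_cyclotomicCount_four_four hp
      (hF.trans hqr) (hF ▸ hn) (even_two_mul n)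
    rw [hF] at hef hN
    refine ⟨⟨e, f, hef, he, hpe⟩, fun e' f' hef' he' hpe' ↦ ?_⟩
    have hqz : (q : ℤ) = (p : ℤ) ^ r := by exact_mod_cast hqr
    have hp2 : p ≠ 2 := by
      rintro rfl
      have : 2 ∣ q := hqr ▸ dvd_pow_self 2 (hr0 hqr)
      lia
    have hee : e = e' := eq_of_pow_eq_sq_add_four_mul_sq hp hp2 (hr0 hqr) (hqz ▸ hef)
      (hqz ▸ hef') he he' hpe hpe'
    rw [hee] at hN
    have hN' : (16 * cyclotomicCount (IsLocalRing.ResidueField R) 4 4 : ℚ) = q - 11 - 6 * e' := by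
      exact_mod_cast hN
    rw [numCliques_three_unitaryCayley hq hm four_ne_zero hn hneg, sub_right_comm, ← hN']
    push_cast
    ring
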